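/- Let $s\ge 0$ and $\alpha\in[0,\frac32)$, and put $p=\frac{3+2s-2\alpha}{3-2\alpha}$. There is a constant $C<\infty$, depending only on $s$ and $\alpha$, such that the following holds for every $\hbar\in(0,1]$. Let $|\hbar\nabla|^{\sigma}$ denote the Fourier multiplier operator on $L^2(\mathbb{R}^3;\mathbb{C})$ with symbol $(\hbar|\xi|)^{\sigma}$ (for the Fourier transform $\hat u(\xi)=\int_{\mathbb{R}^3} u(x)e^{-ix\cdot\xi}\,dx$) on its maximal domain. Let $\gamma$ be a compact self-adjoint operator on $L^2(\mathbb{R}^3)$ such that $0\le|\hbar\nabla|^{\alpha}\gamma|\hbar\nabla|^{\alpha}\le 1$ in the sense of quadratic forms, i.e. $0\le\langle|\hbar\nabla|^{\alpha}u,\gamma|\hbar\nabla|^{\alpha}u\rangle\le\|u\|_{L^2}^2$ for all $u$ in the domain of $|\hbar\nabla|^\alpha$ (so that $\gamma\ge0$). Let $\gamma=\sum_j\lambda_j|\phi_j\rangle\langle\phi_j|$ be a spectral representation with $(\phi_j)$ orthonormal, and let $$\rho_\gamma^\hbar(x)=(2\pi\hbar)^3\gamma(x,x)=(2\pi\hbar)^3\sum_j\lambda_j|\phi_j(x)|^2\in[0,\infty]$$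 be the semi-classical density of $\gamma$. Then $\rho^\hbar_\gamma$ is measurable and $$\|\rho_\gamma^\hbar\|_{L^p(\mathbb{R}^3)}^{p}\le C\,\mathrm{Tr}^\hbar\big(|\hbar\nabla|^s\gamma|\hbar\nabla|^s\big),\qquad \mathrm{Tr}^\hbar(\cdot)=(2\pi\hbar)^3\,\mathrm{Tr}(\cdot),$$ as an inequality in $[0,\infty]$, where the trace of $|\hbar\nabla|^s\gamma|\hbar\nabla|^s$ is the supremum of $\sum_{i}\langle|\hbar\nabla|^s e_i,\gamma|\hbar\nabla|^s e_i\rangle$ over all finite orthonormal families $(e_i)$ in the domain of $|\hbar\nabla|^s$. -/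

import Mathlib

open MeasureTheory
open scoped ENNReal NNReal FourierTransform

noncomputable section

/-- Physical space `ℝ³`. -/
abbrev Space3 : Type := EuclideanSpace ℝ (Fin 3)

/-- The Hilbert space `L²(ℝ³)` of complex-valued functions. -/
abbrev L2Space3 : Type := Lp ℂ 2 (volume : Measure Space3)

/-- The symbol of `|ħ∇|^s`. Mathlib's Fourier transform has the phase `exp (-2πi x·ξ)`, so the
frequency written `ξ` in the convention with phase `exp (-i x·ξ)` is `2π ξ` here. -/
def hGradSymbol (h s : ℝ) (ξ : Space3) : ℝ := (2 * Real.pi * h * ‖ξ‖) ^ s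

/-- The multiplication of the Fourier transform of `u ∈ L²(ℝ³)` by the symbol of `|ħ∇|^s`. -/
def hGradFourier (h s : ℝ) (u : L2Space3) (ξ : Space3) : ℂ :=
  hGradSymbol h s ξ • (𝓕 u : L2Space3) ξ

theorem hGradFourier_add (h s : ℝ) (u v : L2Space3) :
    hGradFourier h s (u + v) =ᵐ[volume] hGradFourier h s u + hGradFourier h s v := by
  have e : (𝓕 (u + v) : L2Space3) = 𝓕 u + 𝓕 v := FourierTransform.fourier_add u v
  filter_upwards [Lp.coeFn_add (𝓕 u : L2Space3) (𝓕 v : L2Space3)] with ξ hξ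
  simp only [hGradFourier, Pi.add_apply, e] at *
  rw [hξ, smul_add]

theorem hGradFourier_smul (h s : ℝ) (c : ℂ) (u : L2Space3) :
    hGradFourier h s (c • u) =ᵐ[volume] c • hGradFourier h s u := by
  have e : (𝓕 (c • u) : L2Space3) = c • 𝓕 u := FourierTransform.fourier_smul c u
  filter_upwards [Lp.coeFn_smul c (𝓕 u : L2Space3)] with ξ hξ
  simp only [hGradFourier, Pi.smul_apply, e] at *
  rw [hξ, smul_comm]

/-- The (in general unbounded) Fourier multiplier operator `|ħ∇|^s` on `L²(ℝ³)`, with its maximal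
domain: all `u ∈ L²(ℝ³)` whose Fourier transform multiplied by the symbol is still in `L²`. -/
def hGrad (h s : ℝ) : L2Space3 →ₗ.[ℂ] L2Space3 where
  domain :=
    { carrier := {u | MemLp (hGradFourier h s u) 2 volume}
      zero_mem' := by
        have e := hGradFourier_smul h s 0 0
        rw [smul_zero, zero_smul] at e
        exact (memLp_congr_ae e).2 MemLp.zero
      add_mem' := fun {u v} hu hv =>
        (memLp_congr_ae (hGradFourier_add h s u v)).2 (MemLp.add hu hv)
      smul_mem' := fun c u hu =>
        (memLp_congr_ae (hGradFourier_smul h s c u)).2 (MemLp.const_smul hu c) }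
  toFun :=
    { toFun := fun u => 𝓕⁻ (MemLp.toLp (hGradFourier h s u) u.2 : L2Space3)
      map_add' := fun u v => by
        rw [← FourierTransform.fourierInv_add]
        congr 1
        rw [← MemLp.toLp_add]
        exact MemLp.toLp_congr _ _ (hGradFourier_add h s u v)
      map_smul' := fun c u => by
        rw [RingHom.id_apply, ← FourierTransform.fourierInv_smul]
        congr 1
        rw [← MemLp.toLp_const_smul]
        exact MemLp.toLp_congr _ _ (hGradFourier_smul h s c u) }

section Abstract

variable {H : Type*} [NormedAddCommGroup H] [InnerProductSpace ℂ H]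

/-- The quadratic form `u ↦ ⟨u, A γ A u⟩ = ⟨A u, γ A u⟩` on the domain of the (self-adjoint)
operator `A`. -/
def conjForm (A : H →ₗ.[ℂ] H) (γ : H →L[ℂ] H) (u : A.domain) : ℝ :=
  (inner ℂ (A u) (γ (A u))).re

/-- The trace in `[0, ∞]` of `A γ A`, for a densely defined self-adjoint `A` and a bounded `γ ≥ 0`:
the supremum of the sums `∑ i, ⟨e i, A γ A e i⟩` over the finite orthonormal families in the
domain of `A`. -/
def conjTrace (A : H →ₗ.[ℂ] H) (γ : H →L[ℂ] H) : ℝ≥0∞ :=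
  ⨆ (n : ℕ) (e : Fin n → A.domain) (_ : Orthonormal ℂ (fun i => (e i : H))),
    ∑ i, ENNReal.ofReal (conjForm A γ (e i))

/-- The eigenspace of `γ` for the real number `t` (it is trivial unless `t` is an eigenvalue). -/
def eigSpace (γ : H →L[ℂ] H) (t : ℝ) : Submodule ℂ H :=
  Module.End.eigenspace (γ : H →ₗ[ℂ] H) (t : ℂ)

instance eigSpace_complete [CompleteSpace H] (γ : H →L[ℂ] H) (t : ℝ) :
    CompleteSpace (eigSpace γ t) := by
  have hc : IsClosed {u : H | γ u = (t : ℂ) • u} :=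
    isClosed_eq γ.continuous (continuous_const_smul _)
  have e : ((eigSpace γ t : Submodule ℂ H) : Set H) = {u : H | γ u = (t : ℂ) • u} := by
    ext u
    simp [eigSpace]
  exact (e ▸ hc : IsClosed ((eigSpace γ t : Submodule ℂ H) : Set H)).completeSpace_coe

/-- The index set of a chosen orthonormal basis of the eigenspace of `γ` for `t`. -/
def eigIndex [CompleteSpace H] (γ : H →L[ℂ] H) (t : ℝ) : Set (eigSpace γ t) :=
  (exists_hilbertBasis ℂ (eigSpace γ t)).choose

/-- A chosen orthonormal basis of the eigenspace of `γ` for `t`. -/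
def eigBasis [CompleteSpace H] (γ : H →L[ℂ] H) (t : ℝ) :
    HilbertBasis (eigIndex γ t) ℂ (eigSpace γ t) :=
  (exists_hilbertBasis ℂ (eigSpace γ t)).choose_spec.choose

end Abstract

/-- The density `ρ_γ(x) = γ(x, x) = ∑ j, λ j * |φ j (x)|²`, with values in `[0, ∞]`, of a compact
self-adjoint operator `γ = ∑ j, λ j |φ j⟩⟨φ j| ≥ 0`, where the `φ j` are an orthonormal family of
eigenfunctions. The sum is grouped by eigenvalues: `t` runs over the eigenvalues of `γ` (all other
`t`, and `t = 0`, contribute nothing), and `i` over an orthonormal basis of the eigenspace of `t`.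
Another choice of eigenfunctions changes `ρ_γ` only on a null set. -/
def density (γ : L2Space3 →L[ℂ] L2Space3) (x : Space3) : ℝ≥0∞ :=
  ∑' t : ℝ, ∑' i : eigIndex γ t,
    ENNReal.ofReal t * ‖((eigBasis γ t i : eigSpace γ t) : L2Space3) x‖ₑ ^ 2

/-- The semi-classical density `ρ_γ^ħ = (2πħ)³ ρ_γ`. -/
def hDensity (h : ℝ) (γ : L2Space3 →L[ℂ] L2Space3) (x : Space3) : ℝ≥0∞ :=
  ENNReal.ofReal ((2 * Real.pi * h) ^ 3) * density γ x

/-- The semi-classical trace `Tr^ħ(|ħ∇|^s γ |ħ∇|^s) = (2πħ)³ Tr(|ħ∇|^s γ |ħ∇|^s)` in `[0, ∞]`. -/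
def hKineticTrace (h s : ℝ) (γ : L2Space3 →L[ℂ] L2Space3) : ℝ≥0∞ :=
  ENNReal.ofReal ((2 * Real.pi * h) ^ 3) * conjTrace (hGrad h s) γ

end

/-! The argument splits frequencies at every dyadic scale and then optimises the scale pointwise.
Put `d = 3 - 2α`, so that the exponent is `1 + 2s/d`. At scale `R = 2^k`, cut each eigenfunction
`φ_j` into its parts with `ħ|ξ| < R` and `ħ|ξ| ≥ R` (`ξ` in the convention with phase `exp (-i
x·ξ)`).

The low part at a point `x` is the inner product of `φ_j` with a band-limited delta function `w_x`,
so its contribution to the density is `⟨w_x, γ w_x⟩`. Writing `w_x = |ħ∇|^α g` and using `|ħ∇|^α γ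
|ħ∇|^α ≤ 1` bounds this by `‖g‖²`; after scaling, the semi-classical contribution is at most `K
R^d`, with `K` finite because `2α < 3` (`tsum_enorm_fourierInv_ball_le`,
`lintegral_ball_inv_hGradSymbol`). Hence `ρ ≤ 2 K R^d + 2 q_k` almost everywhere, where `q_k` is the
density of the high parts.

Choosing `R^d` comparable to `ρ(x)` forces `q_k(x) ≥ ρ(x)/4`, so `ρ^(1+2s/d)` is at most a constant
times `∑ k, 2^(2sk) q_k` (`exists_rpow_le_tsum_dyadic`). Integrating, Plancherel and the geometric
sum over `2^k ≤ ħ|ξ|` (`exists_tsum_dyadic_le`) produce the weight `(ħ|ξ|)^(2s)`, and the result is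
dominated by the trace (`tsum_lintegral_le_conjTrace`). The geometric sum needs `s > 0`; for `s = 0`
the exponent is `1` and Plancherel suffices. -/

/-! ### Spectral decomposition of compact self-adjoint operators -/

section AbstractSpectral

variable {H : Type*} [NormedAddCommGroup H] [InnerProductSpace ℂ H]

theorem HilbertBasis.hasSum_norm_inner_sq {ι : Type*} (b : HilbertBasis ι ℂ H) (x : H) :
    HasSum (fun i => ‖inner ℂ (b i) x‖ ^ 2) (‖x‖ ^ 2) := by
  have h := Complex.hasSum_re (b.hasSum_inner_mul_inner x x)
  rw [inner_self_eq_norm_sq_to_K] at h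
  convert h using 1
  · ext i
    rw [← inner_conj_symm x (b i), ← Complex.normSq_eq_conj_mul_self, Complex.ofReal_re,
      Complex.normSq_eq_norm_sq]
  · norm_cast

theorem HilbertBasis.tsum_enorm_inner_sq {ι : Type*} (b : HilbertBasis ι ℂ H) (x : H) :
    ∑' i, ‖inner ℂ (b i) x‖ₑ ^ 2 = ‖x‖ₑ ^ 2 := by
  have h := b.hasSum_norm_inner_sq x
  have := ENNReal.ofReal_tsum_of_nonneg (fun i => sq_nonneg _) h.summable
  rw [h.tsum_eq] at this
  simp only [ENNReal.ofReal_pow (norm_nonneg _), ofReal_norm] at this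
  exact this.symm

theorem ofReal_re_inner_eq_tsum {ι : Type*} (b : HilbertBasis ι ℂ H) (lam : ι → ℝ)
    (hlam : ∀ i, 0 ≤ lam i) {γ : H →L[ℂ] H} (hγ : (γ : H →ₗ[ℂ] H).IsSymmetric)
    (hb : ∀ i, γ (b i) = (lam i : ℂ) • b i) (v : H) :
    ENNReal.ofReal (inner ℂ v (γ v)).re
      = ∑' i, ENNReal.ofReal (lam i) * ‖inner ℂ (b i) v‖ₑ ^ 2 := by
  have h := Complex.hasSum_re (b.hasSum_inner_mul_inner v (γ v))
  have e : (fun i => (inner ℂ v (b i) * inner ℂ (b i) (γ v)).re)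
      = fun i => lam i * ‖inner ℂ (b i) v‖ ^ 2 := by
    ext i
    have h1 : inner ℂ (b i) (γ v) = inner ℂ (γ (b i)) v := (hγ (b i) v).symm
    rw [h1, hb i, inner_smul_left, Complex.conj_ofReal, ← inner_conj_symm v (b i), mul_left_comm,
      ← Complex.normSq_eq_conj_mul_self, Complex.normSq_eq_norm_sq]
    norm_cast
  rw [e] at h
  rw [← h.tsum_eq, ENNReal.ofReal_tsum_of_nonneg
    (fun i => mul_nonneg (hlam i) (sq_nonneg _)) h.summable]
  refine tsum_congr fun i => ?_
  rw [ENNReal.ofReal_mul (hlam i), ENNReal.ofReal_pow (norm_nonneg _), ofReal_norm]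

/-- Distinct orthonormal vectors are at distance `√2`, so the balls of radius `1/2` around them are
disjoint, and a separable space has room for only countably many. Countability is what permits
exchanging sums with integrals and collecting null sets. -/
theorem Orthonormal.countable_index [TopologicalSpace.SeparableSpace H] {ι : Type*} {v : ι → H}
    (hv : Orthonormal ℂ v) : Countable ι := by
  have hd : ∀ i j, i ≠ j → 1 ≤ dist (v i) (v j) := by
    intro i j hij
    have h2 : ‖v i - v j‖ * ‖v i - v j‖ = 2 := by
      rw [@norm_sub_mul_self ℂ, hv.2 hij, hv.1 i, hv.1 j]
      norm_num
    rw [dist_eq_norm]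
    nlinarith [norm_nonneg (v i - v j)]
  have hp : (Set.univ : Set ι).PairwiseDisjoint fun i => Metric.ball (v i) (1 / 2) := by
    intro i _ j _ hij
    refine Metric.ball_disjoint_ball ?_
    linarith [hd i j hij]
  have := hp.countable_of_isOpen (fun i _ => Metric.isOpen_ball)
    (fun i _ => ⟨v i, Metric.mem_ball_self (by norm_num)⟩)
  exact Set.countable_univ_iff.1 this

variable [CompleteSpace H]

/-- The eigenvectors entering the density of `γ`, as one family. -/
noncomputable def eigVec (γ : H →L[ℂ] H) (j : Σ t : ℝ, eigIndex γ t) : H :=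
  (eigBasis γ j.1 j.2 : eigSpace γ j.1)

theorem apply_eigVec (γ : H →L[ℂ] H) (j : Σ t : ℝ, eigIndex γ t) :
    γ (eigVec γ j) = (j.1 : ℂ) • eigVec γ j :=
  Module.End.mem_eigenspace_iff.1 (eigBasis γ j.1 j.2).2

theorem orthonormal_eigVec {γ : H →L[ℂ] H} (hγ : (γ : H →ₗ[ℂ] H).IsSymmetric) :
    Orthonormal ℂ (eigVec γ) :=
  (hγ.orthogonalFamily_eigenspaces.comp Complex.ofReal_injective).orthonormal_sigma_orthonormal
    (v_family := fun t i => eigBasis γ t i) fun t => (eigBasis γ t).orthonormal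

/-- By the spectral theorem the eigenspaces have trivial common orthogonal complement. Eigenvalues
of a symmetric operator are real, so the spaces `eigSpace γ t` exhaust them, and each eigenvector is
a convergent sum of the chosen basis vectors. The kernel `t = 0` is included, which makes the family
a basis of the whole space. -/
theorem span_eigVec_orthogonal_eq_bot {γ : H →L[ℂ] H} (hc : IsCompactOperator γ)
    (hγ : (γ : H →ₗ[ℂ] H).IsSymmetric) :
    (Submodule.span ℂ (Set.range (eigVec γ)))ᗮ = ⊥ := by
  rw [eq_bot_iff, ← ContinuousLinearMap.orthogonalComplement_iSup_eigenspaces_eq_bot hc hγ]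
  intro v hv
  rw [← Submodule.iInf_orthogonal, Submodule.mem_iInf]
  intro μ w hw
  by_cases hw0 : w = 0
  · rw [hw0, inner_zero_left]
  have hμ := hγ.conj_eigenvalue_eq_self
    (Module.End.hasEigenvalue_of_hasEigenvector ⟨hw, hw0⟩)
  obtain ⟨t, rfl⟩ := Complex.conj_eq_iff_real.1 hμ
  have hs := ((eigBasis γ t).hasSum_repr ⟨w, hw⟩).mapL (eigSpace γ t).subtypeL
  have hs2 := hs.mapL (innerSL ℂ v)
  have h0 : inner ℂ v w = 0 := by
    refine hs2.unique ?_
    convert hasSum_zero with i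
    simp only [map_smul, Submodule.subtypeL_apply, innerSL_apply_apply]
    have : inner ℂ (eigVec γ ⟨t, i⟩) v = 0 := hv _ (Submodule.subset_span ⟨_, rfl⟩)
    rw [← inner_conj_symm]
    simp only [eigVec] at this
    simp [this]
  rw [← inner_conj_symm, h0, map_zero]

/-- The eigenvectors entering the density of a compact self-adjoint operator, as an orthonormal
basis. -/
noncomputable def eigVecBasis {γ : H →L[ℂ] H} (hc : IsCompactOperator γ)
    (hγ : (γ : H →ₗ[ℂ] H).IsSymmetric) : HilbertBasis (Σ t : ℝ, eigIndex γ t) ℂ H :=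
  HilbertBasis.mkOfOrthogonalEqBot (orthonormal_eigVec hγ) (span_eigVec_orthogonal_eq_bot hc hγ)

theorem coe_eigVecBasis {γ : H →L[ℂ] H} (hc : IsCompactOperator γ)
    (hγ : (γ : H →ₗ[ℂ] H).IsSymmetric) : ⇑(eigVecBasis hc hγ) = eigVec γ :=
  HilbertBasis.coe_mkOfOrthogonalEqBot _ _

end AbstractSpectral

theorem density_eq_tsum (γ : L2Space3 →L[ℂ] L2Space3) (x : Space3) :
    density γ x = ∑' j : Σ t : ℝ, eigIndex γ t, ENNReal.ofReal j.1 * ‖eigVec γ j x‖ₑ ^ 2 :=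
  (ENNReal.tsum_sigma _).symm

instance : TopologicalSpace.SeparableSpace L2Space3 := by
  have : Fact ((2 : ℝ≥0∞) ≠ ∞) := ⟨ENNReal.ofNat_ne_top⟩
  infer_instance

/-! ### Fourier multipliers and the trace in an eigenbasis -/

section FourierMultiplier

/-- The element of `L²(ℝ³)` with Fourier transform `g`. -/
noncomputable def invF (g : Space3 → ℂ) (hg : MemLp g 2 volume) : L2Space3 :=
  𝓕⁻ (hg.toLp g : L2Space3)

theorem fourier_invF (g : Space3 → ℂ) (hg : MemLp g 2 volume) :
    (𝓕 (invF g hg) : L2Space3) = hg.toLp g :=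
  FourierTransform.fourier_fourierInv_eq _

theorem coeFn_fourier_invF (g : Space3 → ℂ) (hg : MemLp g 2 volume) :
    ((𝓕 (invF g hg) : L2Space3) : Space3 → ℂ) =ᵐ[volume] g := by
  rw [fourier_invF]
  exact hg.coeFn_toLp

theorem invF_congr {f g : Space3 → ℂ} (hf : MemLp f 2 volume) (hg : MemLp g 2 volume)
    (h : f =ᵐ[volume] g) : invF f hf = invF g hg := by
  rw [invF, invF, MemLp.toLp_congr hf hg h]

theorem invF_fourier (u : L2Space3) : invF (𝓕 u : L2Space3) (Lp.memLp _) = u := by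
  rw [invF, Lp.toLp_coeFn]
  exact FourierTransform.fourierInv_fourier_eq u

theorem inner_invF_left (g : Space3 → ℂ) (hg : MemLp g 2 volume) (u : L2Space3) :
    inner ℂ (invF g hg) u = ∫ ξ, inner ℂ (g ξ) ((𝓕 u : L2Space3) ξ) := by
  rw [← Lp.inner_fourier_eq, L2.inner_def]
  refine integral_congr_ae ?_
  filter_upwards [coeFn_fourier_invF g hg] with ξ hξ
  rw [hξ]

theorem enorm_Lp_two_sq (u : L2Space3) : ‖u‖ₑ ^ 2 = ∫⁻ x, ‖u x‖ₑ ^ 2 := by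
  rw [Lp.enorm_def, eLpNorm_eq_lintegral_rpow_enorm_toReal (by norm_num) (by norm_num),
    ← ENNReal.rpow_natCast, ← ENNReal.rpow_mul]
  norm_num

theorem enorm_invF_sq (g : Space3 → ℂ) (hg : MemLp g 2 volume) :
    ‖invF g hg‖ₑ ^ 2 = ∫⁻ ξ, ‖g ξ‖ₑ ^ 2 := by
  have h : ‖invF g hg‖ₑ = ‖(𝓕 (invF g hg) : L2Space3)‖ₑ := by
    rw [← ofReal_norm, ← ofReal_norm, Lp.norm_fourier_eq]
  rw [h, enorm_Lp_two_sq]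
  refine lintegral_congr_ae ?_
  filter_upwards [coeFn_fourier_invF g hg] with ξ hξ
  rw [hξ]

theorem enorm_fourier_sq (u : L2Space3) :
    ∫⁻ ξ, ‖(𝓕 u : L2Space3) ξ‖ₑ ^ 2 = ‖u‖ₑ ^ 2 := by
  rw [← enorm_Lp_two_sq, ← ofReal_norm, ← ofReal_norm, Lp.norm_fourier_eq]

theorem hGradFourier_invF (h s : ℝ) (g : Space3 → ℂ) (hg : MemLp g 2 volume) :
    hGradFourier h s (invF g hg) =ᵐ[volume] fun ξ => hGradSymbol h s ξ • g ξ := by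
  filter_upwards [coeFn_fourier_invF g hg] with ξ hξ
  rw [hGradFourier, hξ]

theorem invF_mem_domain {h s : ℝ} {g : Space3 → ℂ} (hg : MemLp g 2 volume)
    (hsg : MemLp (fun ξ => hGradSymbol h s ξ • g ξ) 2 volume) :
    invF g hg ∈ (hGrad h s).domain :=
  (memLp_congr_ae (hGradFourier_invF h s g hg)).2 hsg

theorem hGrad_apply {h s : ℝ} (u : (hGrad h s).domain) :
    hGrad h s u = invF (hGradFourier h s u) u.2 := rfl

theorem hGrad_invF {h s : ℝ} {g : Space3 → ℂ} (hg : MemLp g 2 volume)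
    (hsg : MemLp (fun ξ => hGradSymbol h s ξ • g ξ) 2 volume) :
    hGrad h s ⟨invF g hg, invF_mem_domain hg hsg⟩ = invF _ hsg :=
  invF_congr _ _ (hGradFourier_invF h s g hg)

theorem measurable_hGradSymbol (h s : ℝ) : Measurable (hGradSymbol h s) := by
  unfold hGradSymbol
  fun_prop

theorem hGradSymbol_nonneg {h : ℝ} (hh : 0 < h) (s : ℝ) (ξ : Space3) : 0 ≤ hGradSymbol h s ξ := by
  unfold hGradSymbol
  positivity

theorem hGradSymbol_pos {h : ℝ} (hh : 0 < h) (s : ℝ) {ξ : Space3} (hξ : ξ ≠ 0) :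
    0 < hGradSymbol h s ξ := by
  have := norm_pos_iff.2 hξ
  unfold hGradSymbol
  positivity

theorem hGradSymbol_le {h s : ℝ} (hh : 0 < h) (hs : 0 ≤ s) {ξ : Space3} {r : ℝ} (hξ : ‖ξ‖ ≤ r) :
    hGradSymbol h s ξ ≤ (2 * Real.pi * h * r) ^ s := by
  unfold hGradSymbol
  gcongr

theorem ae_ne_zero_space3 : ∀ᵐ ξ : Space3, ξ ≠ 0 := by
  simp [ae_iff, measure_singleton]

/-- If `g ∈ L²` vanishes outside a ball, then so does its product with the symbol of `|ħ∇|^s`. -/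
theorem memLp_hGradSymbol_smul {h s r : ℝ} (hh : 0 < h) (hs : 0 ≤ s) {g : Space3 → ℂ}
    (hg : MemLp g 2 volume) (h0 : ∀ᵐ ξ, r < ‖ξ‖ → g ξ = 0) :
    MemLp (fun ξ => hGradSymbol h s ξ • g ξ) 2 volume := by
  refine MemLp.of_le_mul (c := (2 * Real.pi * h * r) ^ s) hg
    ((measurable_hGradSymbol h s).aestronglyMeasurable.smul hg.1) ?_
  filter_upwards [h0] with ξ hξ
  by_cases hr : r < ‖ξ‖
  · simp [hξ hr]
  · rw [norm_smul, Real.norm_of_nonneg (hGradSymbol_nonneg hh s ξ)]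
    gcongr
    exact hGradSymbol_le hh hs (not_lt.1 hr)

/-- The functions whose Fourier transform vanishes outside the closed ball of radius `r`. -/
noncomputable def bandLimited (r : ℝ) : Submodule ℂ L2Space3 :=
  ((LpToLpRestrictCLM Space3 ℂ ℂ volume 2 (Metric.closedBall 0 r)ᶜ).comp
    ((Lp.fourierTransformₗᵢ Space3 ℂ).toContinuousLinearEquiv : L2Space3 →L[ℂ] L2Space3)).ker

theorem mem_bandLimited {r : ℝ} {u : L2Space3} :
    u ∈ bandLimited r ↔ ∀ᵐ ξ, r < ‖ξ‖ → (𝓕 u : L2Space3) ξ = 0 := by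
  have h1 : u ∈ bandLimited r ↔
      LpToLpRestrictCLM Space3 ℂ ℂ volume 2 (Metric.closedBall 0 r)ᶜ (𝓕 u : L2Space3) = 0 :=
    Iff.rfl
  have h2 := LpToLpRestrictCLM_coeFn (p := 2) (μ := volume) ℂ (Metric.closedBall (0 : Space3) r)ᶜ
    (𝓕 u : L2Space3)
  have h3 : (∀ᵐ ξ, r < ‖ξ‖ → (𝓕 u : L2Space3) ξ = 0) ↔
      ∀ᵐ ξ ∂(volume.restrict (Metric.closedBall (0 : Space3) r)ᶜ), (𝓕 u : L2Space3) ξ = 0 := by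
    rw [ae_restrict_iff' measurableSet_closedBall.compl]
    simp
  rw [h1, h3, Lp.eq_zero_iff_ae_eq_zero]
  constructor
  · intro h
    filter_upwards [h, h2] with ξ a b
    rw [← b, a]
    rfl
  · intro h
    filter_upwards [h, h2] with ξ a b
    rw [b, a]
    rfl

instance (r : ℝ) : CompleteSpace (bandLimited r) :=
  (ContinuousLinearMap.isClosed_ker _).completeSpace_coe

theorem tsum_conjForm_le_conjTrace {H : Type*} [NormedAddCommGroup H] [InnerProductSpace ℂ H]
    (A : H →ₗ.[ℂ] H) (γ : H →L[ℂ] H) {ι : Type*} (e : ι → A.domain)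
    (he : Orthonormal ℂ fun i => (e i : H)) :
    ∑' i, ENNReal.ofReal (conjForm A γ (e i)) ≤ conjTrace A γ := by
  rw [ENNReal.tsum_eq_iSup_sum]
  refine iSup_le fun F => ?_
  rw [← Finset.sum_coe_sort, ← Fintype.sum_equiv F.equivFin.symm _ _ fun i => rfl]
  exact le_iSup₂_of_le F.card (fun i => e (F.equivFin.symm i)) <|
    le_iSup_of_le (he.comp _ (Subtype.val_injective.comp F.equivFin.symm.injective)) le_rfl

/-- The eigenfunctions need not lie in the domain of `A = |ħ∇|^s`, so they cannot serve as test
families for the trace. Band-limited functions do lie in it: for an orthonormal basis `e i` of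
`bandLimited r`, the sum of `lam j * |⟨b j, A e i⟩|²` over `i` first gives the left side by
Parseval, and over `j` first gives the form values at `e i`. -/
theorem tsum_setLIntegral_le_conjTrace {h s : ℝ} (hh : 0 < h) (hs : 0 ≤ s) {ι : Type*}
    (b : HilbertBasis ι ℂ L2Space3) (lam : ι → ℝ) (hlam : ∀ i, 0 ≤ lam i)
    {γ : L2Space3 →L[ℂ] L2Space3} (hγ : (γ : L2Space3 →ₗ[ℂ] L2Space3).IsSymmetric)
    (hb : ∀ i, γ (b i) = (lam i : ℂ) • b i) (r : ℝ) :
    ∑' j, ENNReal.ofReal (lam j) * ∫⁻ ξ in Metric.closedBall 0 r,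
      ENNReal.ofReal (hGradSymbol h s ξ) ^ 2 * ‖(𝓕 (b j) : L2Space3) ξ‖ₑ ^ 2
      ≤ conjTrace (hGrad h s) γ := by
  obtain ⟨w, e, -⟩ := exists_hilbertBasis ℂ (bandLimited r)
  have hdom : ∀ v : bandLimited r, (v : L2Space3) ∈ (hGrad h s).domain := fun v =>
    memLp_hGradSymbol_smul hh hs (Lp.memLp _) (mem_bandLimited.1 v.2)
  set S : Set Space3 := Metric.closedBall 0 r with hS
  have hSm : MeasurableSet S := measurableSet_closedBall
  have hcut : ∀ j, MemLp (S.indicator (𝓕 (b j) : L2Space3)) 2 volume := fun j =>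
    (Lp.memLp _).indicator hSm
  have hzero : ∀ j, ∀ ξ, r < ‖ξ‖ → S.indicator (𝓕 (b j) : L2Space3) ξ = 0 := fun j ξ hξ =>
    Set.indicator_of_notMem (by simpa [hS] using hξ) _
  have hcut' := fun j => memLp_hGradSymbol_smul hh hs (hcut j) (.of_forall (hzero j))
  -- `v j` is `A` applied to the band-limited part of `b j`; it represents `u ↦ ⟨b j, A u⟩` on
  -- `bandLimited r`.
  set v : ι → L2Space3 := fun j => invF _ (hcut' j) with hv
  have hvmem : ∀ j, v j ∈ bandLimited r := by
    intro j
    rw [mem_bandLimited]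
    filter_upwards [coeFn_fourier_invF _ (hcut' j)] with ξ h1 h2
    rw [h1, hzero j ξ h2, smul_zero]
  have hinner : ∀ j i, inner ℂ (b j) (hGrad h s ⟨(e i : L2Space3), hdom (e i)⟩)
      = inner ℂ (v j) (e i : L2Space3) := by
    intro j i
    rw [← invF_fourier (b j), inner_invF_left, inner_invF_left]
    refine integral_congr_ae ?_
    filter_upwards [coeFn_fourier_invF _ (hdom (e i)), mem_bandLimited.1 (e i).2] with ξ h1 h2
    rw [hGrad_apply, h1]
    simp only [hGradFourier]
    by_cases hξ : r < ‖ξ‖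
    · rw [h2 hξ, smul_zero, inner_zero_right, inner_zero_right]
    · rw [Set.indicator_of_mem (by simpa [hS] using hξ), Complex.real_smul, Complex.real_smul,
        RCLike.inner_apply, RCLike.inner_apply, map_mul, Complex.conj_ofReal]
      ring
  calc _ = ∑' j, ENNReal.ofReal (lam j) * ‖(⟨v j, hvmem j⟩ : bandLimited r)‖ₑ ^ 2 := by
        refine tsum_congr fun j => ?_
        congr 1
        change _ = ‖v j‖ₑ ^ 2
        rw [hv, enorm_invF_sq, ← lintegral_indicator hSm]
        refine lintegral_congr fun ξ => ?_
        by_cases hξ : ξ ∈ S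
        · rw [Set.indicator_of_mem hξ, Set.indicator_of_mem hξ, enorm_smul, mul_pow,
            Real.enorm_of_nonneg (hGradSymbol_nonneg hh s ξ)]
        · simp [Set.indicator_of_notMem hξ]
    _ = ∑' j, ∑' i, ENNReal.ofReal (lam j)
          * ‖inner ℂ (b j) (hGrad h s ⟨(e i : L2Space3), hdom (e i)⟩)‖ₑ ^ 2 := by
        refine tsum_congr fun j => ?_
        rw [ENNReal.tsum_mul_left, ← e.tsum_enorm_inner_sq]
        congr 1
        refine tsum_congr fun i => ?_
        rw [hinner, ← ofReal_norm, ← ofReal_norm, norm_inner_symm]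
        rfl
    _ = ∑' i, ENNReal.ofReal (conjForm (hGrad h s) γ ⟨(e i : L2Space3), hdom (e i)⟩) := by
        rw [ENNReal.tsum_comm]
        refine tsum_congr fun i => ?_
        rw [conjForm, ofReal_re_inner_eq_tsum b lam hlam hγ hb]
    _ ≤ _ := tsum_conjForm_le_conjTrace _ _ _
        (e.orthonormal.comp_linearIsometry (bandLimited r).subtypeₗᵢ)

/-- The trace of `|ħ∇|^s γ |ħ∇|^s` is computed by an orthonormal basis of eigenfunctions. -/
theorem tsum_lintegral_le_conjTrace {h s : ℝ} (hh : 0 < h) (hs : 0 ≤ s) {ι : Type*}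
    (b : HilbertBasis ι ℂ L2Space3) (lam : ι → ℝ) (hlam : ∀ i, 0 ≤ lam i)
    {γ : L2Space3 →L[ℂ] L2Space3} (hγ : (γ : L2Space3 →ₗ[ℂ] L2Space3).IsSymmetric)
    (hb : ∀ i, γ (b i) = (lam i : ℂ) • b i) :
    ∑' j, ENNReal.ofReal (lam j) * ∫⁻ ξ,
      ENNReal.ofReal (hGradSymbol h s ξ) ^ 2 * ‖(𝓕 (b j) : L2Space3) ξ‖ₑ ^ 2
      ≤ conjTrace (hGrad h s) γ := by
  -- Monotone convergence as the radius of the frequency ball tends to infinity.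
  have hmono : Monotone fun n : ℕ => Metric.closedBall (0 : Space3) n := fun m n hmn =>
    Metric.closedBall_subset_closedBall (by exact_mod_cast hmn)
  have hU : ⋃ n : ℕ, Metric.closedBall (0 : Space3) n = Set.univ := Metric.iUnion_closedBall_nat 0
  have e : ∀ f : Space3 → ℝ≥0∞,
      ∫⁻ ξ, f ξ = ⨆ n : ℕ, ∫⁻ ξ in Metric.closedBall (0 : Space3) n, f ξ := by
    intro f
    rw [← setLIntegral_univ, ← hU, setLIntegral_iUnion_of_directed _ hmono.directed_le]
  simp_rw [e, ENNReal.mul_iSup]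
  rw [ENNReal.tsum_eq_iSup_sum]
  refine iSup_le fun F => ?_
  rw [ENNReal.finsetSum_iSup_of_monotone]
  · refine iSup_le fun n => (ENNReal.sum_le_tsum F).trans ?_
    exact tsum_setLIntegral_le_conjTrace hh hs b lam hlam hγ hb n
  · intro j m n hmn
    exact mul_le_mul_right (lintegral_mono_set (hmono hmn)) _

end FourierMultiplier

/-! ### The inverse Fourier transform as an integral -/

section PointwiseInverse

/-- On `L¹ ∩ L²` the inverse Fourier transform of `L²(ℝ³)` is given by the Fourier integral. -/
theorem invF_ae_eq_fourierInv (g : Space3 → ℂ) (hg : MemLp g 2 volume)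
    (hg1 : Integrable g volume) : (invF g hg : Space3 → ℂ) =ᵐ[volume] 𝓕⁻ g := by
  have hcont : Continuous (𝓕⁻ g) :=
    VectorFourier.fourierIntegral_continuous Real.continuous_fourierChar
      (by exact continuous_inner.neg) hg1
  -- Both sides are tested against smooth compactly supported functions. The `L²` transform moves
  -- onto the test function by its distributional definition, and the integral transform by Fubini.
  refine ae_eq_of_integral_contDiff_smul_eq ((Lp.memLp (invF g hg)).locallyIntegrable
    (by norm_num)) hcont.locallyIntegrable fun φ hφ hφc => ?_
  have hφc' : HasCompactSupport fun x => (φ x : ℂ) := hφc.comp_left Complex.ofReal_zero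
  have hφ' : ContDiff ℝ ((⊤ : ℕ∞) : WithTop ℕ∞) fun x => (φ x : ℂ) :=
    Complex.ofRealCLM.contDiff.comp hφ
  set ψ : SchwartzMap Space3 ℂ := hφc'.toSchwartzMap hφ' with hψ
  have h1 := congrArg (fun T => T ψ) (Lp.fourierInv_toTemperedDistribution_eq (hg.toLp g))
  simp only [TemperedDistribution.fourierInv_apply, Lp.toTemperedDistribution_apply] at h1
  have h2 : ∫ x, (𝓕⁻ ψ) x • (hg.toLp g) x = ∫ x, (𝓕⁻ (ψ : Space3 → ℂ)) x • g x := by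
    refine integral_congr_ae ?_
    filter_upwards [hg.coeFn_toLp] with x hx
    rw [hx, SchwartzMap.fourierInv_coe]
  rw [h2] at h1
  have h3 : ∫ x, (𝓕⁻ (ψ : Space3 → ℂ)) x • g x = ∫ x, ψ x • (𝓕⁻ g) x := by
    have := VectorFourier.integral_fourierIntegral_smul_eq_flip (L := -innerₗ Space3)
      Real.continuous_fourierChar (by exact continuous_inner.neg) (ψ.integrable (μ := volume)) hg1
    have hflip : (-innerₗ Space3).flip = -innerₗ Space3 := by
      ext x y
      simp [real_inner_comm]
    rw [hflip] at this
    exact this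
  rw [h3] at h1
  exact h1.symm

end PointwiseInverse

/-! ### Positivity and the low-frequency bound -/

section LowFrequency

variable {h α : ℝ}

/-- The form hypothesis only sees the range of `|ħ∇|^α`. That range contains every function whose
Fourier transform vanishes near the origin, since dividing by the symbol is bounded there; such
functions are dense and `γ` is continuous. -/
theorem nonneg_of_conjForm_nonneg (hh : 0 < h) (hα : 0 ≤ α) {γ : L2Space3 →L[ℂ] L2Space3}
    (hpos : ∀ u : (hGrad h α).domain, 0 ≤ conjForm (hGrad h α) γ u) (v : L2Space3) :
    0 ≤ (inner ℂ v (γ v)).re := by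
  set S : ℕ → Set Space3 := fun n => Metric.ball 0 (1 / ((n : ℝ) + 1)) with hS
  have hSm : ∀ n, MeasurableSet (S n) := fun n => measurableSet_ball
  have hg : ∀ n, MemLp ((S n)ᶜ.indicator (𝓕 v : L2Space3)) 2 volume := fun n =>
    (Lp.memLp _).indicator (hSm n).compl
  have hg' : ∀ n, MemLp ((S n).indicator (𝓕 v : L2Space3)) 2 volume := fun n =>
    (Lp.memLp _).indicator (hSm n)
  have hnn : ∀ n, 0 ≤ (inner ℂ (invF _ (hg n)) (γ (invF _ (hg n)))).re := by
    intro n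
    have hw : MemLp (fun ξ => (hGradSymbol h α ξ)⁻¹ • (S n)ᶜ.indicator (𝓕 v : L2Space3) ξ) 2
        volume := by
      refine MemLp.of_le_mul (c := ((2 * Real.pi * h * (1 / ((n : ℝ) + 1))) ^ α)⁻¹) (hg n)
        ((measurable_hGradSymbol h α).inv.aestronglyMeasurable.smul (hg n).1) (.of_forall ?_)
      intro ξ
      by_cases hξ : ξ ∈ S n
      · simp [hξ]
      · have hle : 1 / ((n : ℝ) + 1) ≤ ‖ξ‖ := by simpa [hS] using hξ
        rw [norm_smul, norm_inv, Real.norm_of_nonneg (hGradSymbol_nonneg hh α ξ)]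
        unfold hGradSymbol
        gcongr
    have e : (fun ξ => hGradSymbol h α ξ • (hGradSymbol h α ξ)⁻¹ •
        (S n)ᶜ.indicator (𝓕 v : L2Space3) ξ) =ᵐ[volume] (S n)ᶜ.indicator (𝓕 v : L2Space3) := by
      filter_upwards [ae_ne_zero_space3] with ξ hξ
      rw [smul_inv_smul₀ (hGradSymbol_pos hh α hξ).ne']
    have := hpos ⟨invF _ hw, invF_mem_domain hw ((memLp_congr_ae e).2 (hg n))⟩
    rwa [conjForm, hGrad_invF hw ((memLp_congr_ae e).2 (hg n)), invF_congr _ (hg n) e] at this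
  have hsub : ∀ n, v - invF _ (hg n) = invF _ (hg' n) := by
    intro n
    rw [sub_eq_iff_eq_add, invF, invF, ← FourierTransform.fourierInv_add, ← MemLp.toLp_add]
    simp only [Set.indicator_self_add_compl, Lp.toLp_coeFn]
    exact (FourierTransform.fourierInv_fourier_eq v).symm
  have hlim : Filter.Tendsto (fun n => invF _ (hg n)) Filter.atTop (nhds v) := by
    -- Dominated convergence: the removed balls shrink to the null set `{0}`.
    have h0 : Filter.Tendsto (fun n => ‖v - invF _ (hg n)‖ₑ ^ 2) Filter.atTop (nhds 0) := by
      simp_rw [hsub, enorm_invF_sq]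
      have := tendsto_lintegral_of_dominated_convergence'
        (μ := (volume : Measure Space3)) (f := fun _ => 0)
        (F := fun n ξ => ‖(S n).indicator (𝓕 v : L2Space3) ξ‖ₑ ^ 2)
        (fun ξ => ‖(𝓕 v : L2Space3) ξ‖ₑ ^ 2) (fun n => (hg' n).1.enorm.pow_const 2)
        (fun n => .of_forall fun ξ => ?_) ?_ ?_
      · simpa using this
      · by_cases hξ : ξ ∈ S n <;> simp [hξ]
      · rw [enorm_fourier_sq]
        exact ENNReal.pow_ne_top enorm_ne_top
      · filter_upwards [ae_ne_zero_space3] with ξ hξ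
        obtain ⟨N, hN⟩ := exists_nat_one_div_lt (norm_pos_iff.2 hξ)
        refine tendsto_const_nhds.congr' ?_
        filter_upwards [Filter.eventually_ge_atTop N] with n hn
        have : ξ ∉ S n := by
          simp only [hS, Metric.mem_ball, dist_zero_right, not_lt]
          exact (Nat.one_div_le_one_div hn).trans hN.le
        simp [this]
    rw [tendsto_iff_edist_tendsto_0]
    have h1 := (ENNReal.continuous_rpow_const (y := (1 / 2 : ℝ))).tendsto 0 |>.comp h0
    rw [ENNReal.zero_rpow_of_pos (by norm_num)] at h1
    refine h1.congr fun n => ?_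
    simp only [Function.comp]
    rw [edist_comm, edist_eq_enorm_sub, ← ENNReal.rpow_natCast, ← ENNReal.rpow_mul]
    norm_num
  have hc : Continuous fun w : L2Space3 => (inner ℂ w (γ w)).re :=
    Complex.continuous_re.comp (continuous_id.inner γ.continuous)
  exact ge_of_tendsto' ((hc.tendsto v).comp hlim) hnn

theorem eigenvalue_nonneg_of_conjForm_nonneg (hh : 0 < h) (hα : 0 ≤ α)
    {γ : L2Space3 →L[ℂ] L2Space3}
    (hpos : ∀ u : (hGrad h α).domain, 0 ≤ conjForm (hGrad h α) γ u) {v : L2Space3} {t : ℝ}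
    (hv : ‖v‖ = 1) (ht : γ v = (t : ℂ) • v) : 0 ≤ t := by
  have := nonneg_of_conjForm_nonneg hh hα hpos v
  rw [ht, inner_smul_right, inner_self_eq_norm_sq_to_K, hv] at this
  simpa using this

/-- The `L²` norm on a ball of the inverse of the symbol of `|ħ∇|^α`. -/
theorem lintegral_ball_inv_hGradSymbol (hh : 0 < h) {R : ℝ} (hR : 0 < R) :
    ENNReal.ofReal ((2 * Real.pi * h) ^ 3) *
      ∫⁻ ξ in Metric.ball 0 (R / (2 * Real.pi * h)), ENNReal.ofReal (hGradSymbol h α ξ)⁻¹ ^ 2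
      = ENNReal.ofReal (R ^ (3 - 2 * α)) *
        ∫⁻ η in Metric.ball (0 : Space3) 1, ENNReal.ofReal (‖η‖ ^ (-(2 * α))) := by
  set c : ℝ := R / (2 * Real.pi * h) with hc
  have hp : 0 < 2 * Real.pi * h := by positivity
  have hc0 : 0 < c := by positivity
  have hmap := Measure.map_addHaar_smul (volume : Measure Space3) hc0.ne'
  rw [finrank_euclideanSpace_fin] at hmap
  -- Substitution `ξ = c • η`, with Jacobian `c ^ 3`; the prefactor `(2πħ)^3` turns it into `R ^ 3`.
  have hvol : (volume : Measure Space3)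
      = ENNReal.ofReal (c ^ 3) • Measure.map (c • ·) (volume : Measure Space3) := by
    rw [hmap, smul_smul, abs_of_pos (by positivity), ← ENNReal.ofReal_mul (by positivity),
      mul_inv_cancel₀ (by positivity), ENNReal.ofReal_one, one_smul]
  have key : ∀ f : Space3 → ℝ≥0∞, Measurable f →
      ∫⁻ ξ, f ξ = ENNReal.ofReal (c ^ 3) * ∫⁻ η, f (c • η) := by
    intro f hf
    conv_lhs => rw [hvol]
    rw [lintegral_smul_measure, lintegral_map hf (measurable_const_smul c), smul_eq_mul]
  rw [← lintegral_indicator measurableSet_ball, ← lintegral_indicator measurableSet_ball, key]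
  swap
  · exact ((measurable_hGradSymbol h α).inv.ennreal_ofReal.pow_const 2).indicator
      measurableSet_ball
  rw [← mul_assoc, ← ENNReal.ofReal_mul (by positivity), ← mul_pow, mul_div_cancel₀ _ hp.ne',
    ← lintegral_const_mul', ← lintegral_const_mul']
  rotate_left
  · exact ENNReal.ofReal_ne_top
  · exact ENNReal.ofReal_ne_top
  refine lintegral_congr fun η => ?_
  have hmem : c • η ∈ Metric.ball (0 : Space3) c ↔ η ∈ Metric.ball (0 : Space3) 1 := by
    simp [norm_smul, abs_of_pos hc0, mul_lt_iff_lt_one_right hc0]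
  by_cases hη : η ∈ Metric.ball (0 : Space3) 1
  · rw [Set.indicator_of_mem (hmem.2 hη), Set.indicator_of_mem hη]
    have e : hGradSymbol h α (c • η) = (R * ‖η‖) ^ α := by
      rw [hGradSymbol, norm_smul, Real.norm_of_nonneg hc0.le, ← mul_assoc, mul_div_cancel₀ _ hp.ne']
    rw [e, ← ENNReal.ofReal_pow (by positivity), ← ENNReal.ofReal_mul (by positivity),
      ← ENNReal.ofReal_mul (by positivity)]
    congr 1
    rw [← Real.rpow_neg (by positivity), ← Real.rpow_natCast (_ ^ (-α)),
      ← Real.rpow_mul (by positivity), Real.mul_rpow hR.le (norm_nonneg _), ← mul_assoc, ← Real.rpow_natCast R,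
      ← Real.rpow_add hR]
    push_cast
    ring_nf
  · rw [Set.indicator_of_notMem (mt hmem.1 hη), Set.indicator_of_notMem hη, mul_zero, mul_zero]

/-- The singularity at the origin has order `2α`, below the dimension `3`. -/
theorem lintegral_unitBall_rpow_ne_top (hα : α < 3 / 2) :
    ∫⁻ η in Metric.ball (0 : Space3) 1, ENNReal.ofReal (‖η‖ ^ (-(2 * α))) ≠ ∞ := by
  have h := integrableOn_ball_of_norm_le_rpow (μ := (volume : Measure Space3)) (r := 1)
    (f := fun η : Space3 => ‖η‖ ^ (-(2 * α))) (C := 1) (α := 2 * α) (by simp)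
    (by simp; linarith) (.of_forall fun η => by
      rw [Real.norm_of_nonneg (by positivity), one_mul])
    (by exact (measurable_norm.pow_const _).aestronglyMeasurable)
  exact ((hasFiniteIntegral_iff_ofReal (.of_forall fun η => by positivity)).1 h.2).ne

/-- The density of the low-frequency part of `γ` is bounded if `|ħ∇|^α γ |ħ∇|^α ≤ 1`. -/
theorem tsum_enorm_fourierInv_ball_le (hh : 0 < h) (hα : α < 3 / 2) {ι : Type*}
    (b : HilbertBasis ι ℂ L2Space3) (lam : ι → ℝ) (hlam : ∀ i, 0 ≤ lam i)
    {γ : L2Space3 →L[ℂ] L2Space3} (hγ : (γ : L2Space3 →ₗ[ℂ] L2Space3).IsSymmetric)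
    (hb : ∀ i, γ (b i) = (lam i : ℂ) • b i)
    (hle : ∀ u : (hGrad h α).domain, conjForm (hGrad h α) γ u ≤ ‖(u : L2Space3)‖ ^ 2)
    {R : ℝ} (hR : 0 < R) (x : Space3) :
    ∑' j, ENNReal.ofReal (lam j) *
      ‖𝓕⁻ ((Metric.ball 0 (R / (2 * Real.pi * h))).indicator (𝓕 (b j) : L2Space3)) x‖ₑ ^ 2
      ≤ ∫⁻ ξ in Metric.ball 0 (R / (2 * Real.pi * h)),
        ENNReal.ofReal (hGradSymbol h α ξ)⁻¹ ^ 2 := by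
  set S : Set Space3 := Metric.ball 0 (R / (2 * Real.pi * h)) with hS
  have hSm : MeasurableSet S := measurableSet_ball
  have hfin : ∫⁻ ξ in S, ENNReal.ofReal (hGradSymbol h α ξ)⁻¹ ^ 2 ≠ ∞ := by
    intro htop
    have := lintegral_ball_inv_hGradSymbol (α := α) hh hR
    rw [← hS, htop, ENNReal.mul_top (by simp; positivity)] at this
    exact ENNReal.mul_ne_top ENNReal.ofReal_ne_top (lintegral_unitBall_rpow_ne_top hα) this.symm
  -- `w` is the Fourier transform of the band-limited delta function at `x`: pairing with it
  -- evaluates the low-frequency part of `b j` at `x`.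
  set w : Space3 → ℂ := S.indicator fun ξ => (Real.fourierChar (-inner ℝ ξ x) : ℂ) with hw
  have hwm : Measurable w := by
    refine Measurable.indicator (Continuous.measurable ?_) hSm
    exact continuous_subtype_val.comp (Real.continuous_fourierChar.comp (by fun_prop))
  have hwn : ∀ ξ, ‖w ξ‖ₑ = S.indicator 1 ξ := by
    intro ξ
    by_cases hξ : ξ ∈ S
    · rw [hw, Set.indicator_of_mem hξ, Set.indicator_of_mem hξ, ← ofReal_norm, Circle.norm_coe]
      simp
    · simp [hw, hξ]
  have hw2 : MemLp w 2 volume := by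
    refine MemLp.of_le_mul (c := 1) (g := S.indicator fun _ => (1 : ℝ))
      (memLp_indicator_const 2 hSm 1 (.inr measure_ball_lt_top.ne)) hwm.aestronglyMeasurable
      (.of_forall fun ξ => ?_)
    by_cases hξ : ξ ∈ S <;> simp [hw, hξ, Circle.norm_coe]
  have hgn : ∀ ξ, ‖(hGradSymbol h α ξ)⁻¹ • w ξ‖ₑ ^ 2
      = S.indicator (fun ξ => ENNReal.ofReal (hGradSymbol h α ξ)⁻¹ ^ 2) ξ := by
    intro ξ
    rw [enorm_smul, hwn, Real.enorm_of_nonneg (inv_nonneg.2 (hGradSymbol_nonneg hh α ξ))]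
    by_cases hξ : ξ ∈ S <;> simp [hξ]
  have hg : MemLp (fun ξ => (hGradSymbol h α ξ)⁻¹ • w ξ) 2 volume := by
    refine ⟨(measurable_hGradSymbol h α).inv.aestronglyMeasurable.smul
      hwm.aestronglyMeasurable, ?_⟩
    rw [eLpNorm_lt_top_iff_lintegral_rpow_enorm_lt_top (by norm_num) (by norm_num)]
    have e : ∀ y : ℝ≥0∞, y ^ (2 : ℝ≥0∞).toReal = y ^ 2 := by
      intro y
      rw [← ENNReal.rpow_natCast]
      norm_num
    simp_rw [e, hgn]
    rw [lintegral_indicator hSm]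
    exact hfin.lt_top
  have e : (fun ξ => hGradSymbol h α ξ • (hGradSymbol h α ξ)⁻¹ • w ξ) =ᵐ[volume] w := by
    filter_upwards [ae_ne_zero_space3] with ξ hξ
    rw [smul_inv_smul₀ (hGradSymbol_pos hh α hξ).ne']
  -- The test function has Fourier transform `symbol⁻¹ • w`, so `|ħ∇|^α` maps it to the band-limited
  -- delta function, and its squared norm is the right-hand side.
  have hform := hle ⟨invF _ hg, invF_mem_domain hg ((memLp_congr_ae e).2 hw2)⟩
  rw [conjForm, hGrad_invF hg ((memLp_congr_ae e).2 hw2), invF_congr _ hw2 e] at hform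
  have h1 := ENNReal.ofReal_le_ofReal hform
  rw [ofReal_re_inner_eq_tsum b lam hlam hγ hb, ENNReal.ofReal_pow (norm_nonneg _), ofReal_norm,
    enorm_invF_sq] at h1
  simp_rw [hgn] at h1
  rw [lintegral_indicator hSm] at h1
  refine le_trans (le_of_eq (tsum_congr fun j => ?_)) h1
  congr 2
  rw [← ofReal_norm, ← ofReal_norm, norm_inner_symm, inner_invF_left, Real.fourierInv_eq]
  congr 2
  refine integral_congr_ae (.of_forall fun ξ => ?_)
  by_cases hξ : ξ ∈ S
  · simp only [hw, Set.indicator_of_mem hξ]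
    rw [RCLike.inner_apply, Circle.smul_def, smul_eq_mul, mul_comm]
    congr 1
    rw [AddChar.map_neg_eq_inv, Circle.coe_inv_eq_conj, RingHomCompTriple.comp_apply]
    rfl
  · simp [hw, hξ]

end LowFrequency

/-! ### Summation and optimisation over dyadic scales -/

section Dyadic

/-- A sum over the dyadic scales below `m` is controlled by its largest term. -/
theorem exists_tsum_dyadic_le {s : ℝ} (hs : 0 < s) : ∃ C : ℝ≥0, ∀ m : ℝ, 0 < m →
    ∑' k : ℤ, (if (2 : ℝ) ^ k ≤ m then ENNReal.ofReal (((2 : ℝ) ^ k) ^ s) else 0)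
      ≤ C * ENNReal.ofReal (m ^ s) := by
  set q : ℝ≥0∞ := ENNReal.ofReal ((2 : ℝ) ^ (-s)) with hq
  have hq1 : q < 1 := by
    rw [hq, ENNReal.ofReal_lt_one]
    exact Real.rpow_lt_one_of_one_lt_of_neg (by norm_num) (by linarith)
  have hfin : (1 - q)⁻¹ ≠ ∞ := ENNReal.inv_ne_top.2 (tsub_pos_of_lt hq1).ne'
  refine ⟨((1 - q)⁻¹).toNNReal, fun m hm => ?_⟩
  rw [ENNReal.coe_toNNReal hfin]
  obtain ⟨k₀, hk₀, hk₁⟩ := exists_mem_Ico_zpow hm (one_lt_two : (1 : ℝ) < 2)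
  have hinj : Function.Injective fun n : ℕ => k₀ - (n : ℤ) := fun a b hab => by
    simp only at hab
    omega
  -- Only `k ≤ k₀` contribute, where `2 ^ k₀ ≤ m < 2 ^ (k₀ + 1)`; with `k = k₀ - n` the terms are
  -- dominated by a geometric series of ratio `2 ^ (-s)`.
  rw [← hinj.tsum_eq]
  · calc _ ≤ ∑' n : ℕ, q ^ n * ENNReal.ofReal (m ^ s) := by
          refine ENNReal.tsum_le_tsum fun n => ?_
          split_ifs
          · rw [hq, ← ENNReal.ofReal_pow (by positivity), ← ENNReal.ofReal_mul (by positivity)]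
            refine ENNReal.ofReal_le_ofReal ?_
            rw [zpow_sub₀ two_ne_zero, zpow_natCast, Real.div_rpow (by positivity) (by positivity),
              div_eq_inv_mul, ← Real.rpow_natCast, ← Real.rpow_natCast, ← Real.rpow_mul two_pos.le,
              ← Real.rpow_mul two_pos.le, ← Real.rpow_neg two_pos.le, neg_mul, mul_comm s]
            gcongr
          · exact zero_le
      _ = _ := by rw [ENNReal.tsum_mul_right, ENNReal.tsum_geometric]
  · intro k hk
    have hle : (2 : ℝ) ^ k ≤ m := by
      by_contra hcon
      simp [hcon] at hk
    have : k < k₀ + 1 := (zpow_lt_zpow_iff_right₀ one_lt_two).1 (hle.trans_lt hk₁)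
    exact ⟨(k₀ - k).toNat, by simp only; omega⟩

/-- If at every dyadic scale `2 ^ k` the number `r` is bounded by a low-frequency part of order
`(2 ^ k) ^ d` and a high-frequency part `q k`, then a power of `r` is bounded by a weighted sum of
the high-frequency parts. -/
theorem exists_rpow_le_tsum_dyadic {K : ℝ≥0∞} (hK : K ≠ ∞) {d σ : ℝ} (hd : 0 < d) (hσ : 0 ≤ σ) :
    ∃ C : ℝ≥0, ∀ (r : ℝ≥0∞) (q : ℤ → ℝ≥0∞),
      (∀ k, r ≤ 2 * (ENNReal.ofReal (((2 : ℝ) ^ k) ^ d) * K) + 2 * q k) →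
      r ^ (1 + σ / d) ≤ C * ∑' k : ℤ, ENNReal.ofReal (((2 : ℝ) ^ k) ^ σ) * q k := by
  -- The added `1` keeps `L` positive when `K = 0`, so that one can divide by it.
  set L : ℝ := K.toReal + 1 with hL
  have hL0 : 0 < L := by positivity
  have hKL : K ≤ ENNReal.ofReal L := by
    rw [ENNReal.le_ofReal_iff_toReal_le hK hL0.le]
    linarith
  have hc : 0 < 4 * (4 * L) ^ (σ / d) * 2 ^ σ := by positivity
  have hp : 0 < 1 + σ / d := by positivity
  -- The factors come from `t ≤ 4 * q k`, from `t ^ (σ / d) = (4 * L) ^ (σ / d) * y ^ σ`, and from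
  -- rounding `y` down to a power of two, `y < 2 * 2 ^ k`.
  refine ⟨Real.toNNReal (4 * (4 * L) ^ (σ / d) * 2 ^ σ), fun r q hr => ?_⟩
  change _ ≤ ENNReal.ofReal _ * _
  rcases eq_or_ne r ∞ with rfl | hrt
  · have h0 : q 0 = ∞ := by
      by_contra hq
      exact (ENNReal.add_ne_top.2 ⟨ENNReal.mul_ne_top ENNReal.ofNat_ne_top
        (ENNReal.mul_ne_top ENNReal.ofReal_ne_top hK), ENNReal.mul_ne_top ENNReal.ofNat_ne_top hq⟩)
        (top_le_iff.1 (hr 0))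
    have h1 : ∑' k : ℤ, ENNReal.ofReal (((2 : ℝ) ^ k) ^ σ) * q k = ∞ :=
      ENNReal.tsum_eq_top_of_eq_top ⟨0, by simp [h0]⟩
    rw [h1, ENNReal.mul_top (by simpa using hc)]
    exact le_top
  rcases eq_or_ne r 0 with rfl | hr0
  · rw [ENNReal.zero_rpow_of_pos hp]
    exact zero_le
  obtain ⟨t, ht, rfl⟩ : ∃ t : ℝ, 0 < t ∧ ENNReal.ofReal t = r :=
    ⟨r.toReal, ENNReal.toReal_pos hr0 hrt, ENNReal.ofReal_toReal hrt⟩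
  -- The optimal scale: at `y`, and hence at the dyadic scale below it, the low-frequency term is at
  -- most `t / 2`, which leaves `q k ≥ t / 4`.
  set y : ℝ := (t / (4 * L)) ^ d⁻¹ with hy
  have hy0 : 0 < y := by positivity
  obtain ⟨k, hk0, hk1⟩ := exists_mem_Ico_zpow hy0 (one_lt_two : (1 : ℝ) < 2)
  have hyd : y ^ d = t / (4 * L) := by
    rw [hy, ← Real.rpow_mul (by positivity), inv_mul_cancel₀ hd.ne', Real.rpow_one]
  have hlow : 2 * (ENNReal.ofReal (((2 : ℝ) ^ k) ^ d) * K) ≤ ENNReal.ofReal (t / 2) := by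
    calc _ ≤ ENNReal.ofReal 2 * (ENNReal.ofReal (((2 : ℝ) ^ k) ^ d) * ENNReal.ofReal L) := by
          rw [ENNReal.ofReal_ofNat]
          gcongr
      _ = ENNReal.ofReal (2 * (((2 : ℝ) ^ k) ^ d * L)) := by
          rw [ENNReal.ofReal_mul (by norm_num), ENNReal.ofReal_mul (by positivity)]
      _ ≤ _ := by
          refine ENNReal.ofReal_le_ofReal ?_
          have : ((2 : ℝ) ^ k) ^ d ≤ y ^ d := by gcongr
          rw [hyd, le_div_iff₀ (by positivity)] at this
          linarith
  have hq : ENNReal.ofReal (t / 4) ≤ q k := by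
    rcases eq_or_ne (q k) ∞ with h | h
    · simp [h]
    have h2 := (hr k).trans (add_le_add_left hlow _)
    rw [← ENNReal.ofReal_toReal h, ← ENNReal.ofReal_ofNat 2, ← ENNReal.ofReal_mul (by norm_num),
      ← ENNReal.ofReal_add (by positivity) (by positivity),
      ENNReal.ofReal_le_ofReal_iff (by positivity)] at h2
    rw [← ENNReal.ofReal_toReal h]
    exact ENNReal.ofReal_le_ofReal (by linarith)
  calc ENNReal.ofReal t ^ (1 + σ / d)
      ≤ ENNReal.ofReal (4 * (4 * L) ^ (σ / d) * 2 ^ σ) *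
        (ENNReal.ofReal (((2 : ℝ) ^ k) ^ σ) * ENNReal.ofReal (t / 4)) := by
        rw [ENNReal.ofReal_rpow_of_pos ht, ← ENNReal.ofReal_mul (by positivity),
          ← ENNReal.ofReal_mul hc.le]
        refine ENNReal.ofReal_le_ofReal ?_
        have h1 : y ^ σ = t ^ (σ / d) / (4 * L) ^ (σ / d) := by
          rw [hy, ← Real.rpow_mul (by positivity), ← Real.div_rpow ht.le (by positivity),
            inv_mul_eq_div]
        have h2 : y ^ σ ≤ 2 ^ σ * ((2 : ℝ) ^ k) ^ σ := by
          rw [← Real.mul_rpow (by norm_num) (by positivity)]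
          refine Real.rpow_le_rpow hy0.le ?_ hσ
          rw [zpow_add_one₀ two_ne_zero] at hk1
          linarith
        rw [h1, div_le_iff₀ (by positivity)] at h2
        rw [Real.rpow_add ht, Real.rpow_one]
        calc t * t ^ (σ / d) ≤ t * (2 ^ σ * ((2 : ℝ) ^ k) ^ σ * (4 * L) ^ (σ / d)) := by gcongr
          _ = _ := by ring
    _ ≤ _ := by
        gcongr
        exact (mul_le_mul_right hq _).trans (ENNReal.le_tsum k)

end Dyadic

/-! ### Splitting into low and high frequencies -/

section Decomposition

/-- The components of `u` with frequencies in `S`. -/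
noncomputable def freqCut (S : Set Space3) (hS : MeasurableSet S) (u : L2Space3) : L2Space3 :=
  invF (S.indicator (𝓕 u : L2Space3)) ((Lp.memLp _).indicator hS)

theorem freqCut_add_compl (S : Set Space3) (hS : MeasurableSet S) (u : L2Space3) :
    freqCut S hS u + freqCut Sᶜ hS.compl u = u := by
  rw [freqCut, freqCut, invF, invF, ← FourierTransform.fourierInv_add, ← MemLp.toLp_add]
  simp only [Set.indicator_self_add_compl, Lp.toLp_coeFn]
  exact FourierTransform.fourierInv_fourier_eq u

theorem lintegral_freqCut (S : Set Space3) (hS : MeasurableSet S) (u : L2Space3) :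
    ∫⁻ x, ‖freqCut S hS u x‖ₑ ^ 2 = ∫⁻ ξ, S.indicator 1 ξ * ‖(𝓕 u : L2Space3) ξ‖ₑ ^ 2 := by
  rw [← enorm_Lp_two_sq, freqCut, enorm_invF_sq]
  refine lintegral_congr fun ξ => ?_
  by_cases hξ : ξ ∈ S <;> simp [hξ]

/-- A ball has finite measure, so the cut-off transform is integrable as well as square integrable.
This passes from an `L²` class to the function defined at every point, to which the pointwise
low-frequency bound applies. -/
theorem freqCut_ball_ae_eq (r : ℝ) (u : L2Space3) :
    (freqCut (Metric.ball 0 r) measurableSet_ball u : Space3 → ℂ) =ᵐ[volume]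
      𝓕⁻ ((Metric.ball 0 r).indicator (𝓕 u : L2Space3)) := by
  refine invF_ae_eq_fourierInv _ _ ((integrable_indicator_iff measurableSet_ball).2 ?_)
  have : IsFiniteMeasure ((volume : Measure Space3).restrict (Metric.ball 0 r)) :=
    isFiniteMeasure_restrict.2 measure_ball_lt_top.ne
  exact ((Lp.memLp (𝓕 u : L2Space3)).restrict _).integrable one_le_two

theorem enorm_add_sq_le (a b : ℂ) : ‖a + b‖ₑ ^ 2 ≤ 2 * ‖a‖ₑ ^ 2 + 2 * ‖b‖ₑ ^ 2 := by
  have h : ‖a + b‖ ^ 2 ≤ 2 * ‖a‖ ^ 2 + 2 * ‖b‖ ^ 2 := by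
    have := norm_add_le a b
    nlinarith [norm_nonneg (a + b), sq_nonneg (‖a‖ - ‖b‖)]
  have := ENNReal.ofReal_le_ofReal h
  rwa [ENNReal.ofReal_add (by positivity) (by positivity), ENNReal.ofReal_mul (by norm_num),
    ENNReal.ofReal_mul (by norm_num), ENNReal.ofReal_pow (norm_nonneg _),
    ENNReal.ofReal_pow (norm_nonneg _), ENNReal.ofReal_pow (norm_nonneg _), ofReal_norm,
    ofReal_norm, ofReal_norm, ENNReal.ofReal_ofNat] at this

theorem aemeasurable_enorm_sq (u : L2Space3) : AEMeasurable (fun x => ‖u x‖ₑ ^ 2) :=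
  (Lp.aestronglyMeasurable u).enorm.pow_const 2

end Decomposition

/-! ### Measurability and the density estimate -/

section Main

theorem aemeasurable_hDensity (h : ℝ) {γ : L2Space3 →L[ℂ] L2Space3}
    (hγ : (γ : L2Space3 →ₗ[ℂ] L2Space3).IsSymmetric) : AEMeasurable (hDensity h γ) := by
  have : Countable (Σ t : ℝ, eigIndex γ t) := (orthonormal_eigVec hγ).countable_index
  have e : hDensity h γ = fun x => ENNReal.ofReal ((2 * Real.pi * h) ^ 3) *
      ∑' j : Σ t : ℝ, eigIndex γ t, ENNReal.ofReal j.1 * ‖eigVec γ j x‖ₑ ^ 2 := by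
    ext x
    rw [hDensity, density_eq_tsum]
  rw [e]
  exact (AEMeasurable.tsum fun j => (aemeasurable_enorm_sq _).const_mul _).const_mul _

theorem eLpNorm_ofReal_rpow {f : Space3 → ℝ≥0∞} {p : ℝ} (hp : 0 < p) :
    eLpNorm f (ENNReal.ofReal p) volume ^ p = ∫⁻ x, f x ^ p := by
  rw [eLpNorm_eq_lintegral_rpow_enorm_toReal (by simpa using hp) ENNReal.ofReal_ne_top,
    ENNReal.toReal_ofReal hp.le, ← ENNReal.rpow_mul, one_div_mul_cancel hp.ne', ENNReal.rpow_one]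
  simp only [enorm_eq_self]

/-- The endpoint `s = 0`, where the symbol is identically `1` and Plancherel turns the integral of
the density into the eigenbasis sum for the trace. -/
theorem lintegral_hDensity_le {h : ℝ} (hh : 0 < h) {γ : L2Space3 →L[ℂ] L2Space3}
    (hc : IsCompactOperator γ) (hγ : (γ : L2Space3 →ₗ[ℂ] L2Space3).IsSymmetric)
    (hnn : ∀ j : Σ t : ℝ, eigIndex γ t, 0 ≤ j.1) :
    ∫⁻ x, hDensity h γ x ≤ hKineticTrace h 0 γ := by
  have : Countable (Σ t : ℝ, eigIndex γ t) := (orthonormal_eigVec hγ).countable_index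
  simp only [hDensity, density_eq_tsum, hKineticTrace]
  rw [lintegral_const_mul' _ _ ENNReal.ofReal_ne_top,
    lintegral_tsum fun j => (aemeasurable_enorm_sq _).const_mul _]
  refine mul_le_mul_right (le_trans (le_of_eq (tsum_congr fun j => ?_))
    (tsum_lintegral_le_conjTrace hh le_rfl (eigVecBasis hc hγ) (fun j => j.1) hnn hγ
      fun j => by rw [coe_eigVecBasis, apply_eigVec])) _
  rw [lintegral_const_mul' _ _ ENNReal.ofReal_ne_top, coe_eigVecBasis, ← enorm_Lp_two_sq,
    ← enorm_fourier_sq]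
  simp [hGradSymbol]

theorem exists_lintegral_hDensity_rpow_le {s α : ℝ} (hs : 0 < s) (hα : α < 3 / 2) :
    ∃ C : ℝ≥0, ∀ h : ℝ, 0 < h → ∀ γ : L2Space3 →L[ℂ] L2Space3, IsCompactOperator γ →
      (γ : L2Space3 →ₗ[ℂ] L2Space3).IsSymmetric →
      (∀ j : Σ t : ℝ, eigIndex γ t, 0 ≤ j.1) →
      (∀ u : (hGrad h α).domain, conjForm (hGrad h α) γ u ≤ ‖(u : L2Space3)‖ ^ 2) →
      ∫⁻ x, hDensity h γ x ^ (1 + 2 * s / (3 - 2 * α)) ≤ C * hKineticTrace h s γ := by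
  obtain ⟨C₁, hC₁⟩ := exists_rpow_le_tsum_dyadic (lintegral_unitBall_rpow_ne_top hα)
    (d := 3 - 2 * α) (σ := 2 * s) (by linarith) (by linarith)
  obtain ⟨C₂, hC₂⟩ := exists_tsum_dyadic_le (s := 2 * s) (by linarith)
  refine ⟨C₁ * C₂, fun h hh γ hc hγ hnn hle => ?_⟩
  have : Countable (Σ t : ℝ, eigIndex γ t) := (orthonormal_eigVec hγ).countable_index
  have hp : 0 < 2 * Real.pi * h := by positivity
  set D : ℝ≥0∞ := ENNReal.ofReal ((2 * Real.pi * h) ^ 3) with hD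
  have hDt : D ≠ ∞ := ENNReal.ofReal_ne_top
  set b := eigVecBasis hc hγ with hb
  have hbγ : ∀ j, γ (b j) = ((j.1 : ℝ) : ℂ) • b j := fun j => by
    rw [hb, coe_eigVecBasis, apply_eigVec]
  set S : ℤ → Set Space3 := fun k => Metric.ball 0 ((2 : ℝ) ^ k / (2 * Real.pi * h)) with hS
  have hSm : ∀ k, MeasurableSet (S k) := fun k => measurableSet_ball
  set q : ℤ → Space3 → ℝ≥0∞ := fun k x =>
    D * ∑' j, ENNReal.ofReal j.1 * ‖freqCut (S k)ᶜ (hSm k).compl (b j) x‖ₑ ^ 2 with hq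
  have hqm : ∀ k, AEMeasurable (q k) := fun k =>
    (AEMeasurable.tsum fun j => (aemeasurable_enorm_sq _).const_mul _).const_mul _
  -- The eigenfunctions are only classes modulo null sets; since scales and eigenfunctions are
  -- countable, one null set serves for all of them.
  have hpt : ∀ᵐ x, ∀ k, hDensity h γ x ≤ 2 * (ENNReal.ofReal (((2 : ℝ) ^ k) ^ (3 - 2 * α)) *
      ∫⁻ η in Metric.ball (0 : Space3) 1, ENNReal.ofReal (‖η‖ ^ (-(2 * α)))) + 2 * q k x := by
    have hsplit : ∀ᵐ x, ∀ (k : ℤ) j, b j x =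
        freqCut (S k) (hSm k) (b j) x + freqCut (S k)ᶜ (hSm k).compl (b j) x := by
      refine ae_all_iff.2 fun k => ae_all_iff.2 fun j => ?_
      filter_upwards [Lp.coeFn_add (freqCut (S k) (hSm k) (b j))
        (freqCut (S k)ᶜ (hSm k).compl (b j))] with x hx
      rw [freqCut_add_compl] at hx
      exact hx
    have hlow : ∀ᵐ x, ∀ (k : ℤ) j, freqCut (S k) (hSm k) (b j) x =
        𝓕⁻ ((S k).indicator (𝓕 (b j) : L2Space3)) x :=
      ae_all_iff.2 fun k => ae_all_iff.2 fun j => freqCut_ball_ae_eq _ _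
    filter_upwards [hsplit, hlow] with x hx hx' k
    have h2k : (0 : ℝ) < 2 ^ k := by positivity
    rw [← lintegral_ball_inv_hGradSymbol hh h2k, hDensity, density_eq_tsum]
    simp only [hq]
    rw [← hD, mul_left_comm 2, mul_left_comm 2 D (∑' _, _), ← mul_add]
    gcongr
    refine le_trans ?_ (add_le_add_left (mul_le_mul_right
      (tsum_enorm_fourierInv_ball_le hh hα b (fun j => j.1) hnn hγ hbγ hle h2k x) 2) _)
    rw [← ENNReal.tsum_mul_left, ← ENNReal.tsum_mul_left, ← ENNReal.tsum_add]
    refine ENNReal.tsum_le_tsum fun j => ?_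
    rw [mul_left_comm 2, mul_left_comm 2, ← mul_add]
    gcongr
    rw [← coe_eigVecBasis hc hγ, ← hb, hx k j, ← hx' k j]
    exact enorm_add_sq_le _ _
  calc ∫⁻ x, hDensity h γ x ^ (1 + 2 * s / (3 - 2 * α))
      ≤ ∫⁻ x, C₁ * ∑' k : ℤ, ENNReal.ofReal (((2 : ℝ) ^ k) ^ (2 * s)) * q k x := by
        refine lintegral_mono_ae ?_
        filter_upwards [hpt] with x hx using hC₁ _ _ hx
    _ = C₁ * (D * ∑' k : ℤ, ∑' j, ENNReal.ofReal j.1 * ∫⁻ ξ,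
          ENNReal.ofReal (((2 : ℝ) ^ k) ^ (2 * s)) * (S k)ᶜ.indicator 1 ξ
            * ‖(𝓕 (b j) : L2Space3) ξ‖ₑ ^ 2) := by
        rw [lintegral_const_mul' _ _ ENNReal.coe_ne_top,
          lintegral_tsum fun k => (hqm k).const_mul _, ← ENNReal.tsum_mul_left (a := D)]
        congr 1
        refine tsum_congr fun k => ?_
        simp only [hq]
        rw [lintegral_const_mul' _ _ ENNReal.ofReal_ne_top, lintegral_const_mul' _ _ hDt,
          lintegral_tsum fun j => (aemeasurable_enorm_sq _).const_mul _, mul_left_comm,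
          ← ENNReal.tsum_mul_left (a := ENNReal.ofReal (((2 : ℝ) ^ k) ^ (2 * s)))]
        congr 1
        refine tsum_congr fun j => ?_
        rw [lintegral_const_mul' _ _ ENNReal.ofReal_ne_top, lintegral_freqCut, mul_left_comm,
          ← lintegral_const_mul' _ _ ENNReal.ofReal_ne_top]
        simp only [mul_assoc]
    _ = C₁ * (D * ∑' j, ENNReal.ofReal j.1 * ∫⁻ ξ,
          (∑' k : ℤ, ENNReal.ofReal (((2 : ℝ) ^ k) ^ (2 * s)) * (S k)ᶜ.indicator 1 ξ)
            * ‖(𝓕 (b j) : L2Space3) ξ‖ₑ ^ 2) := by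
        rw [ENNReal.tsum_comm]
        congr 2
        refine tsum_congr fun j => ?_
        have hind : ∀ k, Measurable ((S k)ᶜ.indicator (1 : Space3 → ℝ≥0∞)) := fun k =>
          measurable_one.indicator (hSm k).compl
        simp only [← ENNReal.tsum_mul_right]
        rw [ENNReal.tsum_mul_left, lintegral_tsum]
        exact fun k => ((hind k).const_mul _).aemeasurable.mul (aemeasurable_enorm_sq (𝓕 (b j)))
    -- For fixed `ξ ≠ 0` the indicators select the scales `2 ^ k ≤ 2πħ‖ξ‖`, and their weighted sum
    -- is at most `C₂` times the squared symbol.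
    _ ≤ C₁ * (D * ∑' j, ENNReal.ofReal j.1 * ∫⁻ ξ,
          C₂ * (ENNReal.ofReal (hGradSymbol h s ξ) ^ 2 * ‖(𝓕 (b j) : L2Space3) ξ‖ₑ ^ 2)) := by
        gcongr C₁ * (D * ?_)
        refine ENNReal.tsum_le_tsum fun j => mul_le_mul_right (lintegral_mono_ae ?_) _
        filter_upwards [ae_ne_zero_space3] with ξ hξ
        rw [← mul_assoc]
        gcongr
        have hm : 0 < 2 * Real.pi * h * ‖ξ‖ := mul_pos hp (norm_pos_iff.2 hξ)
        have hsym : ENNReal.ofReal (hGradSymbol h s ξ) ^ 2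
            = ENNReal.ofReal ((2 * Real.pi * h * ‖ξ‖) ^ (2 * s)) := by
          rw [hGradSymbol, ← ENNReal.ofReal_pow (by positivity), ← Real.rpow_natCast,
            ← Real.rpow_mul hm.le, mul_comm s]
          norm_num
        rw [hsym]
        refine le_trans (le_of_eq (tsum_congr fun k => ?_)) (hC₂ _ hm)
        have hmem : ξ ∈ (S k)ᶜ ↔ (2 : ℝ) ^ k ≤ 2 * Real.pi * h * ‖ξ‖ := by
          simp only [hS, Set.mem_compl_iff, Metric.mem_ball, dist_zero_right, not_lt]
          rw [div_le_iff₀ hp, mul_comm]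
        by_cases hk : (2 : ℝ) ^ k ≤ 2 * Real.pi * h * ‖ξ‖
        · rw [if_pos hk, Set.indicator_of_mem (hmem.2 hk), Pi.one_apply, mul_one]
        · rw [if_neg hk, Set.indicator_of_notMem (mt hmem.1 hk), mul_zero]
    _ = C₁ * C₂ * (D * ∑' j, ENNReal.ofReal j.1 * ∫⁻ ξ,
          ENNReal.ofReal (hGradSymbol h s ξ) ^ 2 * ‖(𝓕 (b j) : L2Space3) ξ‖ₑ ^ 2) := by
        simp only [lintegral_const_mul' _ _ (ENNReal.coe_ne_top (r := C₂))]
        simp only [mul_left_comm _ (C₂ : ℝ≥0∞), ENNReal.tsum_mul_left]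
        ring
    _ ≤ _ := by
        rw [ENNReal.coe_mul, hKineticTrace]
        gcongr
        exact tsum_lintegral_le_conjTrace hh hs.le b (fun j => j.1) hnn hγ hbγ

end Main

theorem mainTheorem8 (s α : ℝ) (hs : 0 ≤ s) (hα0 : 0 ≤ α) (hα : α < 3 / 2) :
    ∃ C : ℝ≥0, ∀ h : ℝ, 0 < h → h ≤ 1 →
      ∀ γ : L2Space3 →L[ℂ] L2Space3, IsCompactOperator γ → IsSelfAdjoint γ →
        (∀ u : (hGrad h α).domain,
          0 ≤ conjForm (hGrad h α) γ u ∧ conjForm (hGrad h α) γ u ≤ ‖(u : L2Space3)‖ ^ 2) →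
        AEMeasurable (hDensity h γ) volume ∧
          eLpNorm (hDensity h γ) (ENNReal.ofReal ((3 + 2 * s - 2 * α) / (3 - 2 * α))) volume
              ^ ((3 + 2 * s - 2 * α) / (3 - 2 * α))
            ≤ (C : ℝ≥0∞) * hKineticTrace h s γ := by
  have hd : 0 < 3 - 2 * α := by linarith
  have hp : 0 < (3 + 2 * s - 2 * α) / (3 - 2 * α) := div_pos (by linarith) hd
  have hpe : (3 + 2 * s - 2 * α) / (3 - 2 * α) = 1 + 2 * s / (3 - 2 * α) := by
    field_simp
    ring
  have hnn : ∀ h : ℝ, 0 < h → ∀ γ : L2Space3 →L[ℂ] L2Space3, IsSelfAdjoint γ →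
      (∀ u : (hGrad h α).domain,
        0 ≤ conjForm (hGrad h α) γ u ∧ conjForm (hGrad h α) γ u ≤ ‖(u : L2Space3)‖ ^ 2) →
      ∀ j : Σ t : ℝ, eigIndex γ t, 0 ≤ j.1 := fun h hh γ hγ hform j =>
    eigenvalue_nonneg_of_conjForm_nonneg hh hα0 (fun u => (hform u).1)
      ((orthonormal_eigVec hγ.isSymmetric).1 j) (apply_eigVec γ j)
  -- For `s = 0` the dyadic weights are all `1` and their sum diverges, so this case is treated
  -- directly, with constant `1`.
  rcases hs.eq_or_lt with rfl | hs
  · refine ⟨1, fun h hh _ γ hc hγ hform => ⟨aemeasurable_hDensity h hγ.isSymmetric, ?_⟩⟩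
    rw [eLpNorm_ofReal_rpow hp, hpe, mul_zero, zero_div, add_zero, ENNReal.coe_one, one_mul]
    simp only [ENNReal.rpow_one]
    exact lintegral_hDensity_le hh hc hγ.isSymmetric (hnn h hh γ hγ hform)
  · obtain ⟨C, hC⟩ := exists_lintegral_hDensity_rpow_le hs hα
    refine ⟨C, fun h hh _ γ hc hγ hform => ⟨aemeasurable_hDensity h hγ.isSymmetric, ?_⟩⟩
    rw [eLpNorm_ofReal_rpow hp, hpe]
    exact hC h hh γ hc hγ.isSymmetric (hnn h hh γ hγ hform) fun u => (hform u).2
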